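/- Theorem (Milman for semilattices). A semilattice is a partially ordered set $S$ in which any two elements $x, y$ have a supremum $x \oplus y$. A subset $T \subseteq S$ (possibly empty) is called convex if $x \oplus y \in T$ for all $x, y \in T$; the convex hull $\operatorname{co}(A)$ of $A \subseteq S$ is the smallest convex subset of $S$ containing $A$, and, when $S$ carries a topology, its closed convex hull $\overline{\operatorname{co}}(A)$ is the topological closure of $\operatorname{co}(A)$. A point $x$ is an extreme point of $K \subseteq S$ if $x \in K$ and $x \notin \operatorname{co}(K \setminus \{x\})$; the set of extreme points of $K$ is denoted by $\operatorname{ex} K$. A topological semilattice is a semilattice with a Hausdorff topology for which $(x,y) \mapsto x \oplus y$ is (jointly) continuous from $S \times S$ to $S$; it is locally convex if every point has a basis of (not necessarily open) convex neighbourhoods. Let $S$ be a locally convex topological semilattice, and let $K$ be a closed convex subset of $S$ that is locally compact in the subspace topology. Then for every compact subset $A$ of $K$ such that $K = \overline{\operatorname{co}}(A)$, we have $\operatorname{ex} K \subseteq A$. -/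

import Mathlib

open Topology

namespace SemilatticeConvexity

/-- A topology on a join-semilattice is locally convex if every point has a basis of
neighbourhoods that are subsemilattices. -/
class LocallyConvexSemilattice (S : Type*) [SemilatticeSup S] [TopologicalSpace S] : Prop where
  hasBasis_nhds : ∀ x : S, (𝓝 x).HasBasis (fun U : Set S => U ∈ 𝓝 x ∧ SupClosed U) id

/-- The closed convex hull of `A`: the closure of the subsemilattice generated by `A`
(`supClosure A` is the set of joins of nonempty finite subsets of `A`). -/
def closedConvexHull {S : Type*} [SemilatticeSup S] [TopologicalSpace S] (A : Set S) : Set S :=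
  closure (supClosure A)

/-- The extreme points of `A`: the elements `x` of `A` that do not belong to the
subsemilattice generated by `A \ {x}`. -/
def extremePts {S : Type*} [SemilatticeSup S] (A : Set S) : Set S :=
  {x | x ∈ A ∧ x ∉ supClosure (A \ {x})}

end SemilatticeConvexity

open Set

namespace SemilatticeConvexity

variable {S : Type*} [SemilatticeSup S]

/-! Suppose an extreme point `x` of `K` is not in `A`. Then finitely many compact convex subsets of
`K \ {x}` cover `A`. Two such sets `C`, `D` have hull `C ∪ D ∪ (C ⊔ D)`, which is again compact and
avoids `x` because `K \ {x}` is convex. So `A` lies in one compact, hence closed, convex subset of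
`K \ {x}`; it must contain the closed hull `K`, which is absurd. -/

/-- Removing an extreme point from a subsemilattice leaves a subsemilattice. -/
theorem supClosed_diff_singleton_of_mem_extremePts {K : Set S} (hK : SupClosed K) {x : S}
    (hx : x ∈ extremePts K) : SupClosed (K \ {x}) := by
  intro a ha b hb
  refine ⟨hK ha.1 hb.1, fun h => hx.2 ?_⟩
  exact mem_singleton_iff.1 h ▸
    supClosed_supClosure (subset_supClosure ha) (subset_supClosure hb)

/-- The join of two subsemilattices `C` and `D`, in the lattice of subsemilattices. -/
theorem supClosed_union_union_image2 {C D : Set S} (hC : SupClosed C) (hD : SupClosed D) :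
    SupClosed (C ∪ D ∪ image2 (· ⊔ ·) C D) := by
  rintro _ ((ha | ha) | ⟨a, ha, b, hb, rfl⟩) _ ((hc | hc) | ⟨c, hc, d, hd, rfl⟩)
  · exact .inl (.inl (hC ha hc))
  · exact .inr ⟨_, ha, _, hc, rfl⟩
  · exact .inr ⟨_, hC ha hc, _, hd, sup_assoc _ _ _⟩
  · exact .inr ⟨_, hc, _, ha, sup_comm _ _⟩
  · exact .inl (.inr (hD ha hc))
  · exact .inr ⟨_, hc, _, hD ha hd, sup_left_comm _ _ _⟩
  · exact .inr ⟨_, hC ha hc, _, hb, sup_right_comm _ _ _⟩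
  · exact .inr ⟨_, ha, _, hD hb hc, (sup_assoc _ _ _).symm⟩
  · exact .inr ⟨_, hC ha hc, _, hD hb hd, sup_sup_sup_comm _ _ _ _⟩

variable [TopologicalSpace S]

theorem supClosed_closure [ContinuousSup S] {C : Set S} (hC : SupClosed C) :
    SupClosed (closure C) := fun _ ha _ hb =>
  map_mem_closure₂ continuous_sup ha hb fun _ ha _ hb => hC ha hb

/-- In a locally compact subsemilattice, every point `a` other than `x` has a compact convex
neighbourhood that avoids `x`. -/
theorem exists_compact_supClosed_nhdsWithin [T2Space S] [ContinuousSup S]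
    [LocallyConvexSemilattice S] {K : Set S} [LocallyCompactSpace K] (hK : SupClosed K)
    {a x : S} (ha : a ∈ K) (hax : a ≠ x) :
    ∃ C ∈ 𝓝[K] a, C ⊆ K \ {x} ∧ IsCompact C ∧ SupClosed C := by
  have hopen : ((↑) : K → S) ⁻¹' {x}ᶜ ∈ 𝓝 (⟨a, ha⟩ : K) :=
    continuous_subtype_val.continuousAt (isOpen_compl_singleton.mem_nhds hax)
  obtain ⟨N, hN, hNx, hNc⟩ := local_compact_nhds hopen
  have hNc' : IsCompact (((↑) : K → S) '' N) := hNc.image continuous_subtype_val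
  rw [mem_nhds_subtype] at hN
  obtain ⟨W, hW, hWN⟩ := hN
  obtain ⟨U, ⟨hU, hUc⟩, hUW⟩ := (LocallyConvexSemilattice.hasBasis_nhds a).mem_iff.1 hW
  -- The image of `N` is closed in `S` and misses `x`, so taking the closure of the convex set `U ∩
  -- K` cannot reach `x` or lose compactness.
  have hsub : closure (U ∩ K) ⊆ ((↑) : K → S) '' N :=
    closure_minimal (fun y hy => ⟨⟨y, hy.2⟩, hWN (hUW hy.1), rfl⟩) hNc'.isClosed
  refine ⟨closure (U ∩ K), ?_, hsub.trans ?_, hNc'.of_isClosed_subset isClosed_closure hsub,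
    supClosed_closure (hUc.inter hK)⟩
  · exact Filter.mem_of_superset (Filter.inter_mem (mem_nhdsWithin_of_mem_nhds hU)
      self_mem_nhdsWithin) subset_closure
  · rintro _ ⟨y, hy, rfl⟩
    exact ⟨y.2, hNx hy⟩

end SemilatticeConvexity

theorem mainTheorem3 {S : Type*} [SemilatticeSup S] [TopologicalSpace S] [T2Space S]
    [ContinuousSup S] [SemilatticeConvexity.LocallyConvexSemilattice S]
    (K : Set S) (hK_locallyCompact : LocallyCompactSpace K) (hK_closed : IsClosed K)
    (hK_convex : SupClosed K)
    (A : Set S) (hA_compact : IsCompact A) (hAK : A ⊆ K)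
    (hull : K = SemilatticeConvexity.closedConvexHull A) :
    SemilatticeConvexity.extremePts K ⊆ A := by
  intro x hx
  by_contra hxA
  have hKx := SemilatticeConvexity.supClosed_diff_singleton_of_mem_extremePts hK_convex hx
  obtain ⟨D, hAD, hDK, hDc, hDs⟩ :
      ∃ D, A ⊆ D ∧ D ⊆ K \ {x} ∧ IsCompact D ∧ SupClosed D := by
    -- Lying in a compact convex subset of `K \ {x}` passes to finite unions, so it need only be
    -- checked locally on `A`.
    refine hA_compact.induction_on (p := fun s => ∃ D, s ⊆ D ∧ D ⊆ K \ {x} ∧ IsCompact D ∧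
      SupClosed D) ⟨∅, subset_rfl, empty_subset _, isCompact_empty, supClosed_empty⟩ ?_ ?_ ?_
    · rintro s t hst ⟨D, htD, hD⟩
      exact ⟨D, hst.trans htD, hD⟩
    · rintro s t ⟨C, hsC, hCK, hCc, hCs⟩ ⟨D, htD, hDK, hDc, hDs⟩
      refine ⟨C ∪ D ∪ image2 (· ⊔ ·) C D, (union_subset_union hsC htD).trans subset_union_left,
        union_subset (union_subset hCK hDK) ?_, (hCc.union hDc).union ?_,
        SemilatticeConvexity.supClosed_union_union_image2 hCs hDs⟩
      · exact image2_subset_iff.2 fun a ha b hb => hKx (hCK ha) (hDK hb)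
      · rw [← image_prod]
        exact (hCc.prod hDc).image continuous_sup
    · intro a ha
      obtain ⟨C, hC, h⟩ := SemilatticeConvexity.exists_compact_supClosed_nhdsWithin hK_convex
        (hAK ha) (ne_of_mem_of_not_mem ha hxA)
      exact ⟨C, nhdsWithin_mono a hAK hC, C, subset_rfl, h⟩
  have hKD : K ⊆ D := by
    rw [hull]
    exact closure_minimal (supClosure_min hAD hDs) hDc.isClosed
  exact (hDK (hKD hx.1)).2 rfl
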